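/- Let $n\ge 1$ and write $[k]=\{1,\dots,k\}$. Let $R=\{q_1<\dots<q_r\}\subseteq[n-1]$, and put $q_0=0$, $q_{r+1}=n$. An $R$-permutation is a permutation $\pi=(\pi_1,\dots,\pi_n)$ of $[n]$ with $\pi_{q_{h-1}+1}<\dots<\pi_{q_h}$ for $1\le h\le r+1$. It is $R$-312-avoiding if there are no $1\le h\le r-1$ and indices $1\le a\le q_h<b\le q_{h+1}<c\le n$ with $\pi_b<\pi_c<\pi_a$. The $R$-parabolic Catalan number $C_n^R$ is the number of $R$-312-avoiding $R$-permutations, and the total parabolic Catalan number is $C_n^\Sigma:=\sum_{R\subseteq[n-1]}C_n^R$. For a partition $\lambda=(\lambda_1\ge\dots\ge\lambda_n\ge0)$ and an upper flag $\varphi$ (that is, $\varphi\in[n]^n$ with $\varphi_1\le\dots\le\varphi_n$ and $\varphi_i\ge i$ for all $i$), the flag Schur polynomial $s_\lambda(\varphi;x)$ in the variables $x_1,\dots,x_n$ is $\sum_T x_1^{\theta_1(T)}\cdots x_n^{\theta_n(T)}$, where $T$ runs over the semistandard tableaux of shape $\lambda$ with values in $[n]$ (columns strictly increasing downwards, rows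 weakly increasing from left to right) whose values in row $i$ are at most $\varphi_i$ for every $i$, and $\theta_k(T)$ is the number of values of $T$ equal to $k$. Then for every $m\ge1$, the total parabolic Catalan number $C_n^\Sigma$ equals the number of distinct polynomials that arise as flag Schur polynomials $s_\lambda(\varphi;x)$ in $n$ variables, where $\varphi$ is any upper flag and $\lambda$ is any shape (possibly empty) with at most $n-1$ rows in which there are exactly $m$ columns of each column length that is present. -/

import Mathlib

/-! Indices and values are counted from `0`: the set `[n] = {1, …, n}` is modelled by `Fin n`, and
the index or value `k + 1` of `[n]` is `k : Fin n`. A divider `q ∈ R ⊆ {1, …, n - 1}` keeps its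
value: it separates the first `q` indices, which are the `i : Fin n` with `(i : ℕ) < q`, from the
remaining ones, which are those with `q ≤ (i : ℕ)`. -/

namespace ParabolicCatalan

/-- Two indices lie in the same carrel (block of consecutive indices determined by `R`) when no
divider `q ∈ R` separates them. -/
def SameCarrel {n : ℕ} (R : Finset ℕ) (i j : Fin n) : Prop :=
  ∀ q ∈ R, ((i : ℕ) < q ↔ (j : ℕ) < q)

/-- An `R`-permutation: a permutation of `[n]` whose entries increase on each carrel. -/
def IsRPermutation {n : ℕ} (R : Finset ℕ) (π : Equiv.Perm (Fin n)) : Prop :=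
  ∀ i j : Fin n, i < j → SameCarrel R i j → π i < π j

/-- `π` is `R`-312-containing: there are consecutive elements `p < q` of `R`, an index `a` among the
first `p` ones, an index `b` in the carrel between the dividers `p` and `q`, and an index `c` after
the divider `q`, such that `π a > π b < π c` and `π a > π c`. -/
def IsR312Containing {n : ℕ} (R : Finset ℕ) (π : Equiv.Perm (Fin n)) : Prop :=
  ∃ p ∈ R, ∃ q ∈ R, p < q ∧ (∀ s ∈ R, ¬ (p < s ∧ s < q)) ∧
    ∃ a b c : Fin n, (a : ℕ) < p ∧ p ≤ (b : ℕ) ∧ (b : ℕ) < q ∧ q ≤ (c : ℕ) ∧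
      π b < π a ∧ π b < π c ∧ π c < π a

/-- The `R`-parabolic Catalan number `C_n^R`: the number of `R`-312-avoiding `R`-permutations. -/
noncomputable def parabolicCatalan (n : ℕ) (R : Finset ℕ) : ℕ :=
  Nat.card {π : Equiv.Perm (Fin n) // IsRPermutation R π ∧ ¬ IsR312Containing R π}

/-- The total parabolic Catalan number `C_n^Σ = ∑ C_n^R`, sum over `R ⊆ {1, …, n - 1}`. -/
noncomputable def totalParabolicCatalan (n : ℕ) : ℕ :=
  ∑ R ∈ (Finset.Icc 1 (n - 1)).powerset, parabolicCatalan n R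

/-- The semistandard tableaux of shape `μ` with values in `[n]`. -/
def tableaux (n : ℕ) (μ : YoungDiagram) : Set (SemistandardYoungTableau μ) :=
  {T | ∀ i j : ℕ, (i, j) ∈ μ → T i j < n}

theorem tableaux_finite (n : ℕ) (μ : YoungDiagram) : (tableaux n μ).Finite := by
  rw [← Set.finite_coe_iff]
  refine Finite.of_injective
    (fun (T : tableaux n μ) (c : μ.cells) => (⟨T.1 c.1.1 c.1.2, T.2 _ _ c.2⟩ : Fin n)) ?_
  rintro ⟨T, hT⟩ ⟨U, hU⟩ h
  apply Subtype.ext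
  apply SemistandardYoungTableau.ext
  intro i j
  by_cases hij : (i, j) ∈ μ
  · have := congrFun h ⟨(i, j), hij⟩
    simpa using this
  · rw [T.zeros hij, U.zeros hij]

/-- The row bound set of tableaux `S_μ(β)`: the semistandard tableaux of shape `μ` with values in
`[n]` such that the values in row `i` do not exceed `β i`. -/
def rowBoundSet {n : ℕ} (μ : YoungDiagram) (β : Fin n → Fin n) :
    Set (SemistandardYoungTableau μ) :=
  {T | T ∈ tableaux n μ ∧ ∀ (i : Fin n) (j : ℕ), ((i : ℕ), j) ∈ μ → T i j ≤ (β i : ℕ)}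

theorem rowBoundSet_finite {n : ℕ} (μ : YoungDiagram) (β : Fin n → Fin n) :
    (rowBoundSet μ β).Finite :=
  (tableaux_finite n μ).subset fun _ hT => hT.1

/-- The content `Θ(T)`: the number of occurrences in `T` of each value `k`. -/
noncomputable def content (n : ℕ) {μ : YoungDiagram} (T : SemistandardYoungTableau μ) :
    Fin n →₀ ℕ :=
  Finsupp.equivFunOnFinite.symm fun k => (μ.cells.filter fun c => T c.1 c.2 = (k : ℕ)).card

/-- The row bound sum `s_μ(β; x) = ∑ x^Θ(T)`, sum over the tableaux `T ∈ S_μ(β)`. -/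
noncomputable def rowBoundSum {n : ℕ} (μ : YoungDiagram) (β : Fin n → Fin n) :
    MvPolynomial (Fin n) ℤ :=
  ∑ T ∈ (rowBoundSet_finite μ β).toFinset, MvPolynomial.monomial (content n T) 1

/-- An upper flag: a weakly increasing tuple `φ` with `φ_i ≥ i` for all `i`. -/
def IsUpperFlag {n : ℕ} (φ : Fin n → Fin n) : Prop :=
  Monotone φ ∧ ∀ i, i ≤ φ i

/-- The shapes in which there are exactly `m` columns of each column length that is present. The
columns of `μ` are those with index `j < μ.rowLen 0`. -/
def HasColumnMultiplicity (m : ℕ) (μ : YoungDiagram) : Prop :=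
  ∀ j < μ.rowLen 0,
    ((Finset.range (μ.rowLen 0)).filter fun k => μ.colLen k = μ.colLen j).card = m

/-- The set of polynomials in `n` variables that are flag Schur polynomials on some shape with at
most `n - 1` rows (the number of rows is the length of the first column) in which there are exactly
`m` columns of each column length that is present. -/
def flagSchurPolynomials (n m : ℕ) : Set (MvPolynomial (Fin n) ℤ) :=
  {f | ∃ (μ : YoungDiagram) (φ : Fin n → Fin n), μ.colLen 0 ≤ n - 1 ∧
    HasColumnMultiplicity m μ ∧ IsUpperFlag φ ∧ f = rowBoundSum μ φ}

end ParabolicCatalan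

/-! Both sides count chains of sets. In a tableau with flag bounds `f`, a column of length `l` lies
entrywise below one largest column, whose set of entries is `colSet f l`. These sets increase with
`l`, and the largest columns together form the tableau `maxTableau`.

The polynomial remembers exactly the shape and these sets. The shape is recovered from the highest
weight tableau by a dominance argument (`rowLen_eq_of_rowBoundSum_eq`). For a fixed shape,
`maxTableau` is the only tableau of its content (`entry_eq_of_content_eq`), so equal polynomials
force equal largest columns, and conversely (`rowBoundSum_eq_iff`).

A shape with `m ≥ 1` columns of each length present is given by its set `R` of column lengths. An
`R`-permutation is in turn the chain of its prefix sets at the dividers `q ∈ R`. The chains coming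
from flags are exactly those of the 312-avoiding permutations: `exists_avoiding_of_flag` and
`exists_flag_of_avoiding` give the two directions. -/

namespace ParabolicCatalan

/-! ### Largest columns under a flag bound -/

/-- The largest possible entry in row `i` of a strictly increasing column of length `l` whose entry
in each row `k` is at most `f k`. -/
def flagCol (f : ℕ → ℕ) : ℕ → ℕ → ℕ
  | 0, _ => 0
  | l + 1, i => if i < l then min (flagCol f l i) (f l + i - l) else f l

/-- The set of entries of the largest column of length `l` with row bounds `f`. -/
def colSet (f : ℕ → ℕ) (l : ℕ) : Finset ℕ := (Finset.range l).image (flagCol f l)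

theorem mem_colSet {f : ℕ → ℕ} {l x : ℕ} : x ∈ colSet f l ↔ ∃ i < l, flagCol f l i = x := by
  simp [colSet]

section FlagCol

variable {f : ℕ → ℕ}

/-- Entries drop by at least one per row going up, so the largest entry in row `i` is the minimum of
`f k - k + i` over `i ≤ k < l`. Additive form avoids truncated subtraction. -/
theorem le_flagCol_iff (hf : ∀ k, k ≤ f k) {l i x : ℕ} (hi : i < l) :
    x ≤ flagCol f l i ↔ ∀ k, i ≤ k → k < l → x + k ≤ f k + i := by
  induction l with
  | zero => omega
  | succ l ih =>
    have hl := hf l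
    rw [flagCol]
    split_ifs with h
    · rw [le_min_iff, ih h]
      constructor
      · rintro ⟨h1, h2⟩ k hk hkl
        rcases Nat.lt_succ_iff_lt_or_eq.1 hkl with h3 | rfl
        · exact h1 k hk h3
        · omega
      · intro h1
        refine ⟨fun k hk hkl => h1 k hk (by omega), ?_⟩
        have := h1 l h.le (by omega)
        omega
    · obtain rfl : i = l := by omega
      constructor
      · intro h1 k hk hkl
        obtain rfl : k = i := by omega
        omega
      · intro h1
        have := h1 i le_rfl (by omega)
        omega

theorem exists_flagCol_add_eq (hf : ∀ k, k ≤ f k) {l i : ℕ} (hi : i < l) :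
    ∃ k, i ≤ k ∧ k < l ∧ flagCol f l i + k = f k + i := by
  by_contra! H
  have h := (le_flagCol_iff hf (x := flagCol f l i + 1) hi).2 fun k hk hkl => by
    have h1 := (le_flagCol_iff hf hi).1 le_rfl k hk hkl
    have h2 := H k hk hkl
    omega
  omega

theorem flagCol_add_le (hf : ∀ k, k ≤ f k) {l i k : ℕ} (hik : i ≤ k) (hk : k < l) :
    flagCol f l i + k ≤ f k + i :=
  (le_flagCol_iff hf (hik.trans_lt hk)).1 le_rfl k hik hk

theorem flagCol_le (hf : ∀ k, k ≤ f k) {l i : ℕ} (hi : i < l) : flagCol f l i ≤ f i := by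
  have := flagCol_add_le hf le_rfl hi
  omega

theorem flagCol_add_le_flagCol_add (hf : ∀ k, k ≤ f k) {l i j : ℕ} (hij : i ≤ j) (hj : j < l) :
    flagCol f l i + j ≤ flagCol f l j + i := by
  obtain ⟨k, hk, hkl, h⟩ := exists_flagCol_add_eq hf hj
  have := flagCol_add_le hf (hij.trans hk) hkl
  omega

theorem flagCol_lt_flagCol (hf : ∀ k, k ≤ f k) {l i j : ℕ} (hij : i < j) (hj : j < l) :
    flagCol f l i < flagCol f l j := by
  have := flagCol_add_le_flagCol_add hf hij.le hj
  omega

theorem flagCol_anti (hf : ∀ k, k ≤ f k) {l l' i : ℕ} (hi : i < l) (hl : l ≤ l') :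
    flagCol f l' i ≤ flagCol f l i :=
  (le_flagCol_iff hf hi).2 fun _ hk hkl => flagCol_add_le hf hk (hkl.trans_le hl)

/-- An entry that is not kept when the column grows lands on the run of consecutive values that ends
at `f l` in row `l`. -/
theorem flagCol_succ_eq_or (hf : ∀ k, k ≤ f k) {l i : ℕ} (hi : i < l + 1) :
    (i < l ∧ flagCol f (l + 1) i = flagCol f l i) ∨ flagCol f (l + 1) i + l = f l + i := by
  obtain ⟨k, hk, hkl, h⟩ := exists_flagCol_add_eq hf hi
  rcases Nat.lt_succ_iff_lt_or_eq.1 hkl with h3 | rfl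
  · have hil : i < l := by omega
    have h1 := flagCol_anti hf hil (l.le_add_right 1)
    have h2 := flagCol_add_le hf hk h3
    left
    exact ⟨hil, by omega⟩
  · exact Or.inr h

theorem card_colSet (hf : ∀ k, k ≤ f k) (l : ℕ) : (colSet f l).card = l := by
  rw [colSet, Finset.card_image_of_injOn, Finset.card_range]
  intro i hi j hj hij
  simp only [Finset.coe_range, Set.mem_Iio] at hi hj
  rcases lt_trichotomy i j with h | h | h
  · have := flagCol_lt_flagCol hf h hj
    omega
  · exact h
  · have := flagCol_lt_flagCol hf h hi
    omega

theorem colSet_subset_succ (hf : ∀ k, k ≤ f k) (hm : Monotone f) (l : ℕ) :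
    colSet f l ⊆ colSet f (l + 1) := by
  intro x hx
  obtain ⟨i, hi, rfl⟩ := mem_colSet.1 hx
  rcases flagCol_succ_eq_or hf (show i < l + 1 by omega) with ⟨-, h⟩ | h
  · exact mem_colSet.2 ⟨i, by omega, h⟩
  · have h1 := flagCol_anti hf hi (l.le_add_right 1)
    have h2 := flagCol_le hf hi
    have h3 := hm hi.le
    have hl := hf l
    obtain ⟨e, he⟩ := Nat.exists_eq_add_of_le h1
    -- If the entry of row `i` drops by `e`, its old value reappears `e` rows further down, on the
    -- run ending at `f l`.
    refine mem_colSet.2 ⟨i + e, by omega, ?_⟩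
    rcases flagCol_succ_eq_or hf (show i + e < l + 1 by omega) with ⟨h4, h5⟩ | h5
    · have h6 := flagCol_add_le_flagCol_add hf (Nat.le_add_right i e) h4
      have h7 := flagCol_add_le hf (show i + e ≤ l by omega) (Nat.lt_add_one l)
      omega
    · omega

theorem colSet_mono (hf : ∀ k, k ≤ f k) (hm : Monotone f) : Monotone (colSet f) :=
  monotone_nat_of_le_succ (colSet_subset_succ hf hm)

/-- This is 312-avoidance for largest columns. A value `b` new at length `q + 1` lies on the run
ending at `f q`, and `x ≤ f q` by monotonicity, so the run also contains every `z` between them. -/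
theorem mem_colSet_of_lt_of_lt (hf : ∀ k, k ≤ f k) (hm : Monotone f) {p q x b z : ℕ} (hpq : p ≤ q)
    (hx : x ∈ colSet f p) (hb : b ∈ colSet f q) (hbp : b ∉ colSet f p) (hbz : b < z)
    (hzx : z < x) : z ∈ colSet f q := by
  induction q, hpq using Nat.le_induction with
  | base => exact absurd hb hbp
  | succ q hpq ih =>
    by_cases hbq : b ∈ colSet f q
    · exact colSet_subset_succ hf hm q (ih hbq)
    obtain ⟨i, hi, rfl⟩ := mem_colSet.1 hb
    rcases flagCol_succ_eq_or hf hi with ⟨h1, h2⟩ | h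
    · exact absurd (mem_colSet.2 ⟨i, h1, h2.symm⟩) hbq
    obtain ⟨j, hj, rfl⟩ := mem_colSet.1 (colSet_mono hf hm hpq hx)
    have h3 := flagCol_le hf hj
    have h4 := hm hj.le
    refine mem_colSet.2 ⟨z + q - f q, by omega, ?_⟩
    have h5 := flagCol_add_le_flagCol_add hf (show i ≤ z + q - f q by omega)
      (show z + q - f q < q + 1 by omega)
    have h6 := flagCol_add_le hf (show z + q - f q ≤ q by omega) (Nat.lt_add_one q)
    omega

theorem flagCol_eq_of_mem_colSet (hf : ∀ k, k ≤ f k) {l : ℕ} {g : ℕ → ℕ}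
    (hg : ∀ i j, i < j → j < l → g i < g j) (hgm : ∀ i < l, g i ∈ colSet f l) {i : ℕ} (hi : i < l) :
    g i = flagCol f l i := by
  have h1 := Finset.orderEmbOfFin_unique (card_colSet hf l) (f := fun x : Fin l => g x)
    (fun x => hgm x x.2) (fun a b hab => hg a b hab b.2)
  have h2 := Finset.orderEmbOfFin_unique (card_colSet hf l) (f := fun x : Fin l => flagCol f l x)
    (fun x => mem_colSet.2 ⟨x, x.2, rfl⟩) (fun a b hab => flagCol_lt_flagCol hf hab b.2)
  exact congrFun (h1.trans h2.symm) ⟨i, hi⟩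

end FlagCol

/-! ### Upper flags as functions on the natural numbers -/

/-- The extension of a tuple in `[n]` to all natural numbers. -/
def extendFlag {n : ℕ} (φ : Fin n → Fin n) (k : ℕ) : ℕ := if h : k < n then φ ⟨k, h⟩ else k

section ExtendFlag

variable {n : ℕ} {φ : Fin n → Fin n}

theorem extendFlag_fin (i : Fin n) : extendFlag φ i = φ i := by simp [extendFlag]

theorem extendFlag_lt {k : ℕ} (hk : k < n) : extendFlag φ k < n := by simp [extendFlag, hk]

theorem IsUpperFlag.le_extendFlag (hφ : IsUpperFlag φ) (k : ℕ) : k ≤ extendFlag φ k := by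
  unfold extendFlag
  split_ifs with h
  · exact hφ.2 ⟨k, h⟩
  · exact le_rfl

theorem IsUpperFlag.monotone_extendFlag (hφ : IsUpperFlag φ) : Monotone (extendFlag φ) := by
  intro a b hab
  by_cases hb : b < n
  · have ha : a < n := by omega
    simp only [extendFlag, ha, hb, dif_pos]
    exact hφ.1 hab
  · by_cases ha : a < n
    · have := extendFlag_lt (φ := φ) ha
      have := hφ.le_extendFlag b
      omega
    · simpa [extendFlag, ha, hb] using hab

end ExtendFlag

/-! ### The shape and the largest columns are read off the polynomial -/

section MaxTableau

variable {n : ℕ} {φ ψ : Fin n → Fin n} {μ ν : YoungDiagram}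

/-- The largest semistandard tableau with row bounds `f`. -/
def maxTableau (μ : YoungDiagram) (f : ℕ → ℕ) (hf : ∀ k, k ≤ f k) : SemistandardYoungTableau μ where
  entry i j := if (i, j) ∈ μ then flagCol f (μ.colLen j) i else 0
  row_weak' {i j1 j2} hj hc := by
    have h1 : (i, j1) ∈ μ := μ.up_left_mem le_rfl hj.le hc
    simp only [h1, hc, if_true]
    exact flagCol_anti hf (YoungDiagram.mem_iff_lt_colLen.1 hc) (μ.colLen_anti _ _ hj.le)
  col_strict' {i1 i2 j} hi hc := by
    have h1 : (i1, j) ∈ μ := μ.up_left_mem hi.le le_rfl hc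
    simp only [h1, hc, if_true]
    exact flagCol_lt_flagCol hf hi (YoungDiagram.mem_iff_lt_colLen.1 hc)
  zeros' h := by simp [h]

theorem maxTableau_apply {f : ℕ → ℕ} {hf : ∀ k, k ≤ f k} {i j : ℕ} (h : (i, j) ∈ μ) :
    maxTableau μ f hf i j = flagCol f (μ.colLen j) i := by
  change (if (i, j) ∈ μ then flagCol f (μ.colLen j) i else 0) = _
  simp [h]

theorem add_le_add_of_col (T : SemistandardYoungTableau μ) {i k j : ℕ} (hik : i ≤ k)
    (hk : (k, j) ∈ μ) : T i j + k ≤ T k j + i := by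
  induction k, hik using Nat.le_induction with
  | base => exact le_rfl
  | succ k hik ih =>
    have h1 := ih (μ.up_left_mem k.le_succ le_rfl hk)
    have h2 := T.col_strict k.lt_add_one hk
    omega

theorem le_entry (T : SemistandardYoungTableau μ) {i j : ℕ} (h : (i, j) ∈ μ) : i ≤ T i j := by
  have := add_le_add_of_col T i.zero_le h
  omega

theorem lt_of_mem (hμ : μ.colLen 0 ≤ n - 1) {i j : ℕ} (h : (i, j) ∈ μ) : i < n := by
  have h1 := YoungDiagram.mem_iff_lt_colLen.1 h
  have h2 := μ.colLen_anti 0 j j.zero_le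
  omega

theorem mem_rowBoundSet_iff (hμ : μ.colLen 0 ≤ n - 1) (hφ : IsUpperFlag φ)
    {T : SemistandardYoungTableau μ} :
    T ∈ rowBoundSet μ φ ↔
      ∀ i j, (i, j) ∈ μ → T i j ≤ flagCol (extendFlag φ) (μ.colLen j) i := by
  constructor
  · rintro ⟨-, h⟩ i j hij
    rw [le_flagCol_iff hφ.le_extendFlag (YoungDiagram.mem_iff_lt_colLen.1 hij)]
    intro k hik hk
    rw [← YoungDiagram.mem_iff_lt_colLen] at hk
    have h1 := add_le_add_of_col T hik hk
    have h2 := h ⟨k, lt_of_mem hμ hk⟩ j hk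
    have h3 := extendFlag_fin (φ := φ) ⟨k, lt_of_mem hμ hk⟩
    simp only at h2 h3
    omega
  · intro h
    have h' : ∀ i j, (i, j) ∈ μ → T i j ≤ extendFlag φ i := fun i j hij =>
      (h i j hij).trans (flagCol_le hφ.le_extendFlag (YoungDiagram.mem_iff_lt_colLen.1 hij))
    refine ⟨fun i j hij => (h' i j hij).trans_lt (extendFlag_lt (lt_of_mem hμ hij)), ?_⟩
    intro i j hij
    rw [← extendFlag_fin]
    exact h' i j hij

theorem maxTableau_mem (hμ : μ.colLen 0 ≤ n - 1) (hφ : IsUpperFlag φ) :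
    maxTableau μ (extendFlag φ) hφ.le_extendFlag ∈ rowBoundSet μ φ :=
  (mem_rowBoundSet_iff hμ hφ).2 fun _ _ hij => (maxTableau_apply hij).le

theorem highestWeight_mem (hμ : μ.colLen 0 ≤ n - 1) (hφ : IsUpperFlag φ) :
    SemistandardYoungTableau.highestWeight μ ∈ rowBoundSet μ φ := by
  constructor
  · intro i j hij
    simpa [hij] using lt_of_mem hμ hij
  · intro i j hij
    simpa [hij] using hφ.2 i

theorem coeff_rowBoundSum (μ : YoungDiagram) (φ : Fin n → Fin n) (d : Fin n →₀ ℕ) :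
    (rowBoundSum μ φ).coeff d =
      (((rowBoundSet_finite μ φ).toFinset.filter fun T => content n T = d).card : ℤ) := by
  classical
  simp [rowBoundSum, MvPolynomial.coeff_sum, MvPolynomial.coeff_monomial, Finset.sum_boole]

/-- Coefficients count tableaux, so no monomial cancels. -/
theorem exists_content_eq (h : rowBoundSum μ φ = rowBoundSum ν ψ) {T : SemistandardYoungTableau μ}
    (hT : T ∈ rowBoundSet μ φ) : ∃ U ∈ rowBoundSet ν ψ, content n U = content n T := by
  have h1 : (rowBoundSum ν ψ).coeff (content n T) ≠ 0 := by
    rw [← h, coeff_rowBoundSum, Nat.cast_ne_zero]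
    exact Finset.card_ne_zero_of_mem (a := T) (by simpa using hT)
  rw [coeff_rowBoundSum, Nat.cast_ne_zero, Finset.card_ne_zero] at h1
  obtain ⟨U, hU⟩ := h1
  exact ⟨U, by simpa using hU⟩

theorem card_filter_entry_mem_eq {T : SemistandardYoungTableau μ} {U : SemistandardYoungTableau ν}
    (h : content n T = content n U) {B : Finset ℕ} (hB : ∀ x ∈ B, x < n) :
    (μ.cells.filter fun c => T c.1 c.2 ∈ B).card = (ν.cells.filter fun c => U c.1 c.2 ∈ B).card := by
  have key : ∀ {ρ : YoungDiagram} (S : SemistandardYoungTableau ρ),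
      (ρ.cells.filter fun c => S c.1 c.2 ∈ B).card =
        ∑ x ∈ B, (ρ.cells.filter fun c => S c.1 c.2 = x).card := by
    intro ρ S
    refine (Finset.card_eq_sum_card_fiberwise (f := fun c : ℕ × ℕ => S c.1 c.2) (t := B)
      fun c hc => (Finset.mem_filter.1 hc).2).trans ?_
    refine Finset.sum_congr rfl fun x hx => ?_
    congr 1
    ext c
    simp only [Finset.mem_filter]
    constructor
    · rintro ⟨⟨h1, h2⟩, h3⟩
      exact ⟨h1, h3⟩
    · rintro ⟨h1, rfl⟩
      exact ⟨⟨h1, hx⟩, rfl⟩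
  rw [key, key]
  exact Finset.sum_congr rfl fun x hx => DFunLike.congr_fun h ⟨x, hB x hx⟩

theorem card_filter_lt_eq_sum (μ : YoungDiagram) (k : ℕ) :
    (μ.cells.filter fun c => c.1 < k).card = ∑ i ∈ Finset.range k, μ.rowLen i := by
  rw [Finset.card_eq_sum_card_fiberwise (f := Prod.fst) (t := Finset.range k)
    (fun c hc => by simpa using (Finset.mem_filter.1 hc).2)]
  refine Finset.sum_congr rfl fun i hi => ?_
  rw [μ.rowLen_eq_card]
  congr 1
  ext c
  simp only [Finset.mem_filter, YoungDiagram.mem_row_iff, YoungDiagram.mem_cells]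
  have := Finset.mem_range.1 hi
  constructor
  · rintro ⟨⟨h1, h2⟩, h3⟩
    exact ⟨h1, h3⟩
  · rintro ⟨h1, rfl⟩
    exact ⟨⟨h1, this⟩, rfl⟩

/-- The highest weight tableau has all of its first `k` rows filled with values below `k`. In any
tableau such values occur only in the first `k` rows, because an entry is at least its row index. -/
theorem sum_rowLen_le (hμ : μ.colLen 0 ≤ n - 1) (hφ : IsUpperFlag φ)
    (h : rowBoundSum μ φ = rowBoundSum ν ψ) {k : ℕ} (hk : k ≤ n) :
    ∑ i ∈ Finset.range k, μ.rowLen i ≤ ∑ i ∈ Finset.range k, ν.rowLen i := by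
  obtain ⟨U, -, hU⟩ := exists_content_eq h (highestWeight_mem hμ hφ)
  have h1 := card_filter_entry_mem_eq hU (B := Finset.range k) (by simp; omega)
  rw [← card_filter_lt_eq_sum, ← card_filter_lt_eq_sum]
  have h2 : (μ.cells.filter fun c => c.1 < k) = μ.cells.filter fun c =>
      SemistandardYoungTableau.highestWeight μ c.1 c.2 ∈ Finset.range k := by
    refine Finset.filter_congr fun c hc => ?_
    rw [YoungDiagram.mem_cells] at hc
    simp [hc]
  rw [h2, ← h1]
  refine Finset.card_le_card fun c hc => ?_
  simp only [Finset.mem_filter, Finset.mem_range] at hc ⊢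
  exact ⟨hc.1, (le_entry U ((YoungDiagram.mem_cells _).1 hc.1)).trans_lt hc.2⟩

theorem rowLen_eq_zero (hμ : μ.colLen 0 ≤ n - 1) {i : ℕ} (hi : n ≤ i) : μ.rowLen i = 0 := by
  by_contra h
  have := lt_of_mem hμ (YoungDiagram.mem_iff_lt_rowLen.2 (Nat.pos_of_ne_zero h))
  omega

theorem rowLen_eq_of_rowBoundSum_eq (hμ : μ.colLen 0 ≤ n - 1) (hν : ν.colLen 0 ≤ n - 1)
    (hφ : IsUpperFlag φ) (hψ : IsUpperFlag ψ) (h : rowBoundSum μ φ = rowBoundSum ν ψ) (i : ℕ) :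
    μ.rowLen i = ν.rowLen i := by
  have key : ∀ k ≤ n, ∑ i ∈ Finset.range k, μ.rowLen i = ∑ i ∈ Finset.range k, ν.rowLen i :=
    fun k hk => (sum_rowLen_le hμ hφ h hk).antisymm (sum_rowLen_le hν hψ h.symm hk)
  by_cases hi : i < n
  · have h1 := key (i + 1) hi
    rw [Finset.sum_range_succ, Finset.sum_range_succ, key i hi.le] at h1
    omega
  · rw [rowLen_eq_zero hμ (not_lt.1 hi), rowLen_eq_zero hν (not_lt.1 hi)]

theorem eq_of_rowLen_eq (h : ∀ i, μ.rowLen i = ν.rowLen i) : μ = ν := by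
  refine SetLike.ext fun ⟨i, j⟩ => ?_
  rw [YoungDiagram.mem_iff_lt_rowLen,
    YoungDiagram.mem_iff_lt_rowLen, h]

/-- The number of entries of column `j` of `T` that lie in `B`. -/
def colCount (T : SemistandardYoungTableau μ) (B : Finset ℕ) (j : ℕ) : ℕ :=
  ((Finset.range (μ.colLen j)).filter fun i => T i j ∈ B).card

theorem card_filter_entry_mem (T : SemistandardYoungTableau μ) (B : Finset ℕ) :
    (μ.cells.filter fun c => T c.1 c.2 ∈ B).card =
      ∑ j ∈ Finset.range (μ.rowLen 0), colCount T B j := by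
  rw [Finset.card_eq_sum_card_fiberwise (f := Prod.snd) (t := Finset.range (μ.rowLen 0))]
  · refine Finset.sum_congr rfl fun j _ => ?_
    refine Eq.trans ?_ (Finset.card_image_of_injective _ (Prod.mk_left_injective j))
    congr 1
    ext ⟨i, k⟩
    simp only [Finset.mem_filter, Finset.mem_image, Finset.mem_range, YoungDiagram.mem_cells,
      Prod.mk.injEq]
    constructor
    · rintro ⟨⟨h1, h2⟩, rfl⟩
      exact ⟨i, ⟨YoungDiagram.mem_iff_lt_colLen.1 h1, h2⟩, rfl, rfl⟩
    · rintro ⟨i', ⟨h1, h2⟩, rfl, rfl⟩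
      exact ⟨⟨YoungDiagram.mem_iff_lt_colLen.2 h1, h2⟩, rfl⟩
  · rintro ⟨i, j⟩ hc
    have h1 : (i, j) ∈ μ := (YoungDiagram.mem_cells _).1 (Finset.mem_filter.1 hc).1
    simpa using YoungDiagram.mem_iff_lt_rowLen.1 (μ.up_left_mem i.zero_le le_rfl h1)

theorem colCount_le_colLen (T : SemistandardYoungTableau μ) (B : Finset ℕ) (j : ℕ) :
    colCount T B j ≤ μ.colLen j :=
  (Finset.card_filter_le _ _).trans (Finset.card_range _).le

theorem injOn_col (T : SemistandardYoungTableau μ) (j : ℕ) :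
    Set.InjOn (fun i => T i j) (Finset.range (μ.colLen j)) := by
  intro a ha b hb hab
  simp only [Finset.coe_range, Set.mem_Iio, ← YoungDiagram.mem_iff_lt_colLen] at ha hb
  rcases lt_trichotomy a b with h | h | h
  · exact absurd hab (T.col_strict h hb).ne
  · exact h
  · exact absurd hab (T.col_strict h ha).ne'

theorem colCount_le_card (T : SemistandardYoungTableau μ) (B : Finset ℕ) (j : ℕ) :
    colCount T B j ≤ B.card :=
  Finset.card_le_card_of_injOn (fun i => T i j) (fun _ hi => (Finset.mem_filter.1 hi).2)
    ((injOn_col T j).mono (by exact_mod_cast Finset.filter_subset _ _))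

theorem min_le_colCount_maxTableau {f : ℕ → ℕ} (hf : ∀ k, k ≤ f k) (hm : Monotone f) (l j : ℕ) :
    min (μ.colLen j) l ≤ colCount (maxTableau μ f hf) (colSet f l) j := by
  have hsub : colSet f (min (μ.colLen j) l) ⊆
      ((Finset.range (μ.colLen j)).filter fun i =>
        maxTableau μ f hf i j ∈ colSet f l).image fun i => maxTableau μ f hf i j := by
    intro x hx
    obtain ⟨i, hi, rfl⟩ := mem_colSet.1 (colSet_mono hf hm (min_le_left _ _) hx)
    have h1 := maxTableau_apply (hf := hf) (YoungDiagram.mem_iff_lt_colLen.2 hi)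
    refine Finset.mem_image.2 ⟨i, Finset.mem_filter.2 ⟨Finset.mem_range.2 hi, ?_⟩, h1⟩
    rw [h1]
    exact colSet_mono hf hm (min_le_right _ _) hx
  have h := (Finset.card_le_card hsub).trans Finset.card_image_le
  rwa [card_colSet hf] at h

/-- The largest tableau with given flag bounds is the only tableau with its content. -/
theorem entry_eq_of_content_eq {f : ℕ → ℕ} (hf : ∀ k, k ≤ f k) (hm : Monotone f)
    (hn : ∀ l ≤ μ.colLen 0, ∀ x ∈ colSet f l, x < n)
    {T : SemistandardYoungTableau μ} (h : content n T = content n (maxTableau μ f hf)) {i j : ℕ}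
    (hij : (i, j) ∈ μ) : T i j = flagCol f (μ.colLen j) i := by
  have hj0 := μ.colLen_anti 0 j j.zero_le
  -- Each column of the largest tableau meets this set as often as any column of its length can.
  -- Equal contents give equal totals, hence equality column by column; column `j` then lies inside
  -- a set of its own size.
  have hle : ∀ k, colCount T (colSet f (μ.colLen j)) k ≤
      colCount (maxTableau μ f hf) (colSet f (μ.colLen j)) k := fun k => by
    refine le_trans (le_min (colCount_le_colLen T _ k) ?_) (min_le_colCount_maxTableau hf hm _ k)
    exact (colCount_le_card T _ k).trans (card_colSet hf _).le
  have hsum := card_filter_entry_mem_eq h (hn _ hj0)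
  rw [card_filter_entry_mem, card_filter_entry_mem,
    Finset.sum_eq_sum_iff_of_le (fun k _ => hle k)] at hsum
  have hj : j < μ.rowLen 0 :=
    YoungDiagram.mem_iff_lt_rowLen.1 (μ.up_left_mem i.zero_le le_rfl hij)
  have h1 := hsum j (Finset.mem_range.2 hj)
  have h2 := min_le_colCount_maxTableau (μ := μ) hf hm (μ.colLen j) j
  rw [min_self, ← h1] at h2
  have h3 : (Finset.range (μ.colLen j)).filter (fun i => T i j ∈ colSet f (μ.colLen j)) =
      Finset.range (μ.colLen j) :=
    Finset.eq_of_subset_of_card_le (Finset.filter_subset _ _) (by simpa [colCount] using h2)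
  refine flagCol_eq_of_mem_colSet hf (g := fun i => T i j)
    (fun a b hab hb => T.col_strict hab (YoungDiagram.mem_iff_lt_colLen.2 hb)) (fun a ha => ?_)
    (YoungDiagram.mem_iff_lt_colLen.1 hij)
  exact (Finset.mem_filter.1 (h3.ge (Finset.mem_range.2 ha))).2

theorem lt_of_mem_colSet (hφ : IsUpperFlag φ) {l x : ℕ} (hl : l ≤ n)
    (hx : x ∈ colSet (extendFlag φ) l) : x < n := by
  obtain ⟨i, hi, rfl⟩ := mem_colSet.1 hx
  exact (flagCol_le hφ.le_extendFlag hi).trans_lt (extendFlag_lt (by omega))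

theorem flagCol_le_of_rowBoundSum_eq (hμ : μ.colLen 0 ≤ n - 1) (hφ : IsUpperFlag φ)
    (hψ : IsUpperFlag ψ) (h : rowBoundSum μ φ = rowBoundSum μ ψ) {i j : ℕ} (hij : (i, j) ∈ μ) :
    flagCol (extendFlag φ) (μ.colLen j) i ≤ flagCol (extendFlag ψ) (μ.colLen j) i := by
  obtain ⟨U, hU, hUc⟩ := exists_content_eq h (maxTableau_mem hμ hφ)
  rw [← entry_eq_of_content_eq hφ.le_extendFlag hφ.monotone_extendFlag
    (fun l hl x hx => lt_of_mem_colSet hφ (by omega) hx) hUc hij]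
  exact (mem_rowBoundSet_iff hμ hψ).1 hU i j hij

theorem colSet_eq_iff (hφ : IsUpperFlag φ) (hψ : IsUpperFlag ψ) {l : ℕ} :
    colSet (extendFlag φ) l = colSet (extendFlag ψ) l ↔
      ∀ i < l, flagCol (extendFlag φ) l i = flagCol (extendFlag ψ) l i := by
  constructor
  · intro h i hi
    refine flagCol_eq_of_mem_colSet hψ.le_extendFlag
      (fun a b hab hb => flagCol_lt_flagCol hφ.le_extendFlag hab hb) (fun a ha => ?_) hi
    rw [← h]
    exact mem_colSet.2 ⟨a, ha, rfl⟩
  · intro h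
    exact Finset.image_congr fun i hi => h i (by simpa using hi)

/-- Two flag Schur polynomials of the same shape agree if and only if the largest columns of each
length that is present agree. -/
theorem rowBoundSum_eq_iff (hμ : μ.colLen 0 ≤ n - 1) (hφ : IsUpperFlag φ) (hψ : IsUpperFlag ψ) :
    rowBoundSum μ φ = rowBoundSum μ ψ ↔
      ∀ j < μ.rowLen 0,
        colSet (extendFlag φ) (μ.colLen j) = colSet (extendFlag ψ) (μ.colLen j) := by
  constructor
  · intro h j _
    rw [colSet_eq_iff hφ hψ]
    intro i hi
    have hij := YoungDiagram.mem_iff_lt_colLen.2 hi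
    exact (flagCol_le_of_rowBoundSum_eq hμ hφ hψ h hij).antisymm
      (flagCol_le_of_rowBoundSum_eq hμ hψ hφ h.symm hij)
  · intro h
    have hset : rowBoundSet μ φ = rowBoundSet μ ψ := by
      ext T
      rw [mem_rowBoundSet_iff hμ hφ, mem_rowBoundSet_iff hμ hψ]
      refine forall₃_congr fun i j hij => ?_
      have hj : j < μ.rowLen 0 :=
        YoungDiagram.mem_iff_lt_rowLen.1 (μ.up_left_mem i.zero_le le_rfl hij)
      rw [(colSet_eq_iff hφ hψ).1 (h j hj) i (YoungDiagram.mem_iff_lt_colLen.1 hij)]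
    simp only [rowBoundSum, hset]

end MaxTableau

/-! ### Permutations as chains of prefix sets -/

section Permutations

variable {n : ℕ} {R : Finset ℕ} {φ : Fin n → Fin n} {π ρ : Equiv.Perm (Fin n)}

/-- The set of the first `q` entries of a permutation. -/
def prefixSet (π : Equiv.Perm (Fin n)) (q : ℕ) : Finset ℕ :=
  (Finset.univ.filter fun i : Fin n => (i : ℕ) < q).image fun i => (π i : ℕ)

theorem apply_mem_prefixSet {q : ℕ} {i : Fin n} : (π i : ℕ) ∈ prefixSet π q ↔ (i : ℕ) < q := by
  simp [prefixSet, Fin.val_inj]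

theorem lt_of_mem_prefixSet {q x : ℕ} (hx : x ∈ prefixSet π q) : x < n := by
  obtain ⟨i, -, rfl⟩ := Finset.mem_image.1 hx
  exact (π i).2

theorem exists_of_mem_prefixSet {q x : ℕ} (hx : x ∈ prefixSet π q) :
    ∃ i : Fin n, (i : ℕ) < q ∧ (π i : ℕ) = x := by
  simpa [prefixSet] using hx

theorem prefixSet_mono : Monotone (prefixSet π) := by
  intro p q hpq x hx
  obtain ⟨i, hi, rfl⟩ := exists_of_mem_prefixSet hx
  exact apply_mem_prefixSet.2 (hi.trans_le hpq)

theorem card_prefixSet {q : ℕ} (hq : q ≤ n) : (prefixSet π q).card = q := by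
  have hinj : Function.Injective fun i : Fin n => (π i : ℕ) := Fin.val_injective.comp π.injective
  rw [prefixSet, Finset.card_image_of_injective _ hinj, Fin.card_filter_val_lt]
  omega

theorem mem_prefixSet_of_lt {x : ℕ} (hx : x < n) : x ∈ prefixSet π n := by
  have := apply_mem_prefixSet (π := π) (q := n) (i := π.symm ⟨x, hx⟩)
  simpa using this

/-- The avoidance condition for consecutive dividers implies it for all pairs of dividers. -/
theorem not_lt_of_avoiding (h : ¬ IsR312Containing R π) {p q a b c : ℕ} (hp : p ∈ R) (hq : q ∈ R)
    (ha : a ∈ prefixSet π p) (hb : b ∈ prefixSet π q) (hbp : b ∉ prefixSet π p)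
    (hc : c ∉ prefixSet π q) (hbc : b < c) : ¬ c < a := by
  intro hca
  have hpq : p < q := by
    by_contra hle
    exact hbp (prefixSet_mono (not_lt.1 hle) hb)
  -- Take `q'` to be the first divider whose prefix contains `b`, and `p'` below to be the divider
  -- just before it. Then `b` lies in the carrel between them, `a` stays before `p'` and `c` after
  -- `q'`.
  obtain ⟨q', hq', hmin⟩ := Finset.exists_min_image (R.filter fun s => b ∈ prefixSet π s) id
    ⟨q, Finset.mem_filter.2 ⟨hq, hb⟩⟩
  rw [Finset.mem_filter] at hq'
  have hq'q : q' ≤ q := hmin q (Finset.mem_filter.2 ⟨hq, hb⟩)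
  have hpq' : p < q' := by
    by_contra hle
    exact hbp (prefixSet_mono (not_lt.1 hle) hq'.2)
  obtain ⟨p', hp', hmax⟩ := Finset.exists_max_image (R.filter fun s => s < q') id
    ⟨p, Finset.mem_filter.2 ⟨hp, hpq'⟩⟩
  rw [Finset.mem_filter] at hp'
  have hpp' : p ≤ p' := hmax p (Finset.mem_filter.2 ⟨hp, hpq'⟩)
  have hbp' : b ∉ prefixSet π p' := fun hb' => by
    have : q' ≤ p' := hmin p' (Finset.mem_filter.2 ⟨hp'.1, hb'⟩)
    omega
  obtain ⟨i, hi, rfl⟩ := exists_of_mem_prefixSet (prefixSet_mono hpp' ha)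
  obtain ⟨j, hj, rfl⟩ := exists_of_mem_prefixSet hq'.2
  obtain ⟨k, rfl⟩ : ∃ k, (π k : ℕ) = c :=
    ⟨π.symm ⟨c, hca.trans (π i).2⟩, by simp⟩
  have hk : ¬ (k : ℕ) < q' := fun hk => hc (apply_mem_prefixSet.2 (hk.trans_le hq'q))
  rw [apply_mem_prefixSet] at hbp'
  refine h ⟨p', hp'.1, q', hq'.1, hp'.2, fun s hs hlt => ?_, i, j, k, hi, not_lt.1 hbp', hj,
    not_lt.1 hk, hbc.trans hca, hbc, hca⟩
  have : s ≤ p' := hmax s (Finset.mem_filter.2 ⟨hs, hlt.2⟩)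
  omega

/-- An `R`-permutation is determined by the sets of its first `q` entries for `q ∈ R`. -/
theorem eq_of_prefixSet_eq (hπ : IsRPermutation R π) (hρ : IsRPermutation R ρ)
    (h : ∀ q ∈ R, prefixSet π q = prefixSet ρ q) : π = ρ := by
  -- `ρ⁻¹ π` preserves carrels and increases inside each one, so it is a strictly increasing
  -- permutation, hence the identity.
  have hc : ∀ i, SameCarrel R i ((ρ.symm * π) i) := fun i q hq => by
    rw [← apply_mem_prefixSet (π := π), h q hq, ← apply_mem_prefixSet (π := ρ)]
    simp
  have hmono : StrictMono (ρ.symm * π) := by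
    intro i j hij
    by_cases hs : SameCarrel R i j
    · by_contra hle
      have hne : (ρ.symm * π) j ≠ (ρ.symm * π) i := fun h => hij.ne' ((ρ.symm * π).injective h)
      have h1 := hρ _ _ (lt_of_le_of_ne (not_lt.1 hle) hne) fun q hq =>
        ((hc j q hq).symm.trans (hs q hq).symm).trans (hc i q hq)
      have h2 := hπ i j hij hs
      simp only [Equiv.Perm.mul_apply, Equiv.apply_symm_apply] at h1
      exact absurd h1 h2.asymm
    · simp only [SameCarrel, not_forall] at hs
      obtain ⟨q, hq, hne⟩ := hs
      have h1 := hc i q hq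
      have h2 := hc j q hq
      have h3 : (i : ℕ) < j := hij
      rw [Fin.lt_def]
      omega
  have hid : ∀ i, (ρ.symm * π) i = i := fun i => by
    have h1 := hmono.id_le
    have h2 : StrictMono (ρ.symm * π).symm := fun a b hab => by
      by_contra hle
      have := hmono.monotone (not_lt.1 hle)
      simp only [Equiv.apply_symm_apply] at this
      exact absurd hab (not_lt.2 this)
    have h3 := h2.id_le ((ρ.symm * π) i)
    simp only [Equiv.symm_apply_apply, id] at h3
    exact le_antisymm h3 (h1 i)
  ext i
  have := congrArg ρ (hid i)
  simp only [Equiv.Perm.mul_apply, Equiv.apply_symm_apply] at this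
  rw [this]

/-- Every chain of sets of sizes `q ∈ R` consists of the prefix sets of an `R`-permutation. -/
theorem exists_isRPermutation {A : ℕ → Finset ℕ} (hA : Monotone A) (hcard : ∀ q ∈ R, (A q).card = q)
    (hlt : ∀ q ∈ R, ∀ x ∈ A q, x < n) :
    ∃ π : Equiv.Perm (Fin n), IsRPermutation R π ∧ ∀ q ∈ R, prefixSet π q = A q := by
  let lev : Fin n → ℕ := fun v => (R.filter fun q => (v : ℕ) ∉ A q).card
  let key : Fin n → ℕ ×ₗ Fin n := fun v => toLex (lev v, v)
  let π := Tuple.sort key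
  have hmono : Monotone (key ∘ π) := Tuple.monotone_sort key
  have hlev : ∀ q ∈ R, ∀ v w : Fin n, (v : ℕ) ∈ A q → (w : ℕ) ∉ A q → lev v < lev w := by
    intro q hq v w hv hw
    refine Finset.card_lt_card ⟨fun s hs => ?_, fun hsub => ?_⟩
    · rw [Finset.mem_filter] at hs ⊢
      refine ⟨hs.1, fun hws => ?_⟩
      rcases le_total s q with hsq | hsq
      · exact hw (hA hsq hws)
      · exact hs.2 (hA hsq hv)
    · exact (Finset.mem_filter.1 (hsub (Finset.mem_filter.2 ⟨hq, hw⟩))).2 hv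
  have hlow : ∀ q ∈ R, ∀ i j : Fin n, i ≤ j → (π j : ℕ) ∈ A q → (π i : ℕ) ∈ A q := by
    intro q hq i j hij hj
    by_contra hi
    have h1 := hlev q hq _ _ hj hi
    have h2 : lev (π i) ≤ lev (π j) := by
      rcases Prod.Lex.le_iff.1 (hmono hij) with h | h
      · exact h.le
      · exact h.1.le
    omega
  have hmem : ∀ q ∈ R, ∀ i : Fin n, (π i : ℕ) ∈ A q ↔ (i : ℕ) < q := by
    intro q hq i
    have hS : (Finset.univ.filter fun i : Fin n => (π i : ℕ) ∈ A q).card = q := by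
      have hinj : Function.Injective fun i : Fin n => (π i : ℕ) :=
        Fin.val_injective.comp π.injective
      rw [← Finset.card_image_of_injective _ hinj]
      refine (congrArg Finset.card ?_).trans (hcard q hq)
      ext x
      simp only [Finset.mem_image, Finset.mem_filter, Finset.mem_univ, true_and]
      constructor
      · rintro ⟨i, hi, rfl⟩
        exact hi
      · intro hx
        exact ⟨π.symm ⟨x, hlt q hq x hx⟩, by simpa using hx, by simp⟩
    constructor
    · intro hi
      have h1 : Finset.Iic i ⊆ Finset.univ.filter fun i : Fin n => (π i : ℕ) ∈ A q := fun j hj =>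
        Finset.mem_filter.2 ⟨Finset.mem_univ _, hlow q hq j i (Finset.mem_Iic.1 hj) hi⟩
      have h2 := Finset.card_le_card h1
      rw [Fin.card_Iic, hS] at h2
      omega
    · intro hi
      by_contra hni
      have h1 : (Finset.univ.filter fun i : Fin n => (π i : ℕ) ∈ A q) ⊆ Finset.Iio i := fun j hj =>
        Finset.mem_Iio.2 (not_le.1 fun hij => hni (hlow q hq i j hij (Finset.mem_filter.1 hj).2))
      have h2 := Finset.card_le_card h1
      rw [Fin.card_Iio, hS] at h2
      omega
  refine ⟨π, fun i j hij hs => ?_, fun q hq => ?_⟩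
  · have h1 : lev (π i) = lev (π j) := by
      refine congrArg Finset.card (Finset.filter_congr fun q hq => ?_)
      rw [hmem q hq, hmem q hq, hs q hq]
    rcases Prod.Lex.le_iff.1 (hmono hij.le) with h | h
    · exact absurd h1 h.ne
    · exact lt_of_le_of_ne h.2 (π.injective.ne hij.ne)
  · ext x
    constructor
    · intro hx
      obtain ⟨i, hi, rfl⟩ := exists_of_mem_prefixSet hx
      exact (hmem q hq i).2 hi
    · intro hx
      have h1 := hmem q hq (π.symm ⟨x, hlt q hq x hx⟩)
      rw [← apply_mem_prefixSet (π := π)] at h1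
      simpa [hx] using h1

/-- In a 312 pattern the intermediate value `π c` would lie in the largest column of length `q`,
hence among the first `q` entries. -/
theorem exists_avoiding_of_flag (hR : ∀ q ∈ R, q ≤ n) (hφ : IsUpperFlag φ) :
    ∃ π : Equiv.Perm (Fin n), (IsRPermutation R π ∧ ¬ IsR312Containing R π) ∧
      ∀ q ∈ R, prefixSet π q = colSet (extendFlag φ) q := by
  have hle := hφ.le_extendFlag
  have hm := hφ.monotone_extendFlag
  obtain ⟨π, hπ, h⟩ := exists_isRPermutation (n := n) (R := R) (colSet_mono hle hm)
    (fun q _ => card_colSet hle q) (fun q hq x hx => lt_of_mem_colSet hφ (hR q hq) hx)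
  refine ⟨π, ⟨hπ, ?_⟩, h⟩
  rintro ⟨p, hp, q, hq, hpq, -, a, b, c, ha, hb, hbq, hc, -, hbc, hca⟩
  have h1 := mem_colSet_of_lt_of_lt hle hm hpq.le (x := π a) (b := π b) (z := π c)
    (by rwa [← h p hp, apply_mem_prefixSet]) (by rwa [← h q hq, apply_mem_prefixSet])
    (by rw [← h p hp, apply_mem_prefixSet]; omega) hbc hca
  rw [← h q hq, apply_mem_prefixSet] at h1
  omega

/-! ### Recovering a flag from an avoiding permutation -/

/-- The number of elements of `A` below `v`. -/
def countBelow (A : Finset ℕ) (v : ℕ) : ℕ := (A.filter fun x => x < v).card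

theorem countBelow_mono_left {A B : Finset ℕ} (h : A ⊆ B) (v : ℕ) :
    countBelow A v ≤ countBelow B v :=
  Finset.card_le_card (Finset.filter_subset_filter _ h)

theorem countBelow_mono_right (A : Finset ℕ) {v w : ℕ} (h : v ≤ w) :
    countBelow A v ≤ countBelow A w :=
  Finset.card_le_card fun x hx => by
    rw [Finset.mem_filter] at hx ⊢
    exact ⟨hx.1, hx.2.trans_le h⟩

theorem countBelow_le_card (A : Finset ℕ) (v : ℕ) : countBelow A v ≤ A.card :=
  Finset.card_filter_le _ _

theorem countBelow_le_add (A : Finset ℕ) (v w : ℕ) :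
    countBelow A w ≤ countBelow A v + (w - v) := by
  have h1 : (A.filter fun x => x < w) ⊆ (A.filter fun x => x < v) ∪ Finset.Ico v w := by
    intro x hx
    simp only [Finset.mem_union, Finset.mem_filter, Finset.mem_Ico] at hx ⊢
    have := lt_or_ge x v
    tauto
  refine (Finset.card_le_card h1).trans ((Finset.card_union_le _ _).trans ?_)
  rw [Nat.card_Ico, countBelow]

theorem countBelow_eq_add {A : Finset ℕ} {v w : ℕ} (h : v ≤ w)
    (hA : ∀ x, v ≤ x → x < w → x ∈ A) : countBelow A w = countBelow A v + (w - v) := by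
  refine (countBelow_le_add A v w).antisymm ?_
  rw [← Nat.card_Ico, countBelow, ← Finset.card_union_of_disjoint]
  · refine Finset.card_le_card fun x hx => ?_
    simp only [Finset.mem_union, Finset.mem_filter, Finset.mem_Ico] at hx ⊢
    rcases hx with hx | hx
    · exact ⟨hx.1, by omega⟩
    · exact ⟨hA x hx.1 hx.2, hx.2⟩
  · rw [Finset.disjoint_left]
    intro x hx hx'
    simp only [Finset.mem_filter, Finset.mem_Ico] at hx hx'
    omega

/-- The least divider in `R ∪ {n}` beyond `k`. -/
def nextDivider (n : ℕ) (R : Finset ℕ) (k : ℕ) : ℕ :=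
  if h : (R.filter fun q => k < q).Nonempty then (R.filter fun q => k < q).min' h else n

theorem nextDivider_mem_or (k : ℕ) : nextDivider n R k ∈ R ∨ nextDivider n R k = n := by
  unfold nextDivider
  split_ifs with h
  · exact Or.inl (Finset.mem_filter.1 (Finset.min'_mem _ h)).1
  · exact Or.inr rfl

theorem lt_nextDivider {k : ℕ} (hk : k < n) : k < nextDivider n R k := by
  unfold nextDivider
  split_ifs with h
  · exact (Finset.mem_filter.1 (Finset.min'_mem _ h)).2
  · exact hk

theorem nextDivider_le {k q : ℕ} (hq : q ∈ R) (hkq : k < q) : nextDivider n R k ≤ q := by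
  have h : q ∈ R.filter fun q => k < q := Finset.mem_filter.2 ⟨hq, hkq⟩
  rw [nextDivider, dif_pos ⟨q, h⟩]
  exact Finset.min'_le _ _ h

theorem nextDivider_le_top (hR : ∀ q ∈ R, q ≤ n) (k : ℕ) : nextDivider n R k ≤ n := by
  rcases nextDivider_mem_or (n := n) (R := R) k with h | h
  · exact hR _ h
  · exact h.le

theorem nextDivider_mono (hR : ∀ q ∈ R, q ≤ n) {k k' : ℕ} (hk' : k' < n) (h : k ≤ k') :
    nextDivider n R k ≤ nextDivider n R k' := by
  rcases nextDivider_mem_or (n := n) (R := R) k' with h1 | h1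
  · exact nextDivider_le h1 (h.trans_lt (lt_nextDivider hk'))
  · rw [h1]
    exact nextDivider_le_top hR k

theorem exists_gap (hR : ∀ q ∈ R, q ≤ n) (π : Equiv.Perm (Fin n)) (k : Fin n) :
    ∃ v, v ∉ prefixSet π (nextDivider n R k) ∧
      (k : ℕ) < countBelow (prefixSet π (nextDivider n R k)) v := by
  refine ⟨n, fun h => (lt_of_mem_prefixSet h).false, ?_⟩
  rw [countBelow, Finset.filter_true_of_mem fun x hx => lt_of_mem_prefixSet hx,
    card_prefixSet (nextDivider_le_top hR k)]
  exact lt_nextDivider k.2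

/-- Let `q` be the next divider after `k`. The bound `φ k` is the last value of the run of
consecutive values in the prefix set of `q` that contains its element of rank `k` (ranks from `0`).
Here `gap k` is the first value past that run, so `φ k = gap k - 1`. -/
theorem exists_flag_of_avoiding (hR : ∀ q ∈ R, q ≤ n) (h : ¬ IsR312Containing R π) :
    ∃ φ : Fin n → Fin n, IsUpperFlag φ ∧ ∀ q ∈ R, prefixSet π q = colSet (extendFlag φ) q := by
  classical
  let gap : Fin n → ℕ := fun k => Nat.find (exists_gap hR π k)
  have hgap : ∀ k : Fin n, gap k ∉ prefixSet π (nextDivider n R k) ∧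
      (k : ℕ) < countBelow (prefixSet π (nextDivider n R k)) (gap k) :=
    fun k => Nat.find_spec (exists_gap hR π k)
  have hgap_le : ∀ (k : Fin n) (v : ℕ), v ∉ prefixSet π (nextDivider n R k) →
      (k : ℕ) < countBelow (prefixSet π (nextDivider n R k)) v → gap k ≤ v :=
    fun k v h1 h2 => Nat.find_min' _ ⟨h1, h2⟩
  have hgap_n : ∀ k : Fin n, gap k ≤ n := fun k => hgap_le k n (fun h => (lt_of_mem_prefixSet h).false) (by
    rw [countBelow, Finset.filter_true_of_mem fun x hx => lt_of_mem_prefixSet hx,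
      card_prefixSet (nextDivider_le_top hR k)]
    exact lt_nextDivider k.2)
  have hgap_lt : ∀ k : Fin n, (k : ℕ) < gap k := fun k => by
    have h1 := countBelow_le_add (prefixSet π (nextDivider n R k)) 0 (gap k)
    have h2 : countBelow (prefixSet π (nextDivider n R k)) 0 = 0 := by simp [countBelow]
    have h3 := (hgap k).2
    omega
  have hgap_mono : ∀ k k' : Fin n, k ≤ k' → gap k ≤ gap k' := by
    intro k k' hkk
    have hq := nextDivider_mono hR k'.2 hkk
    have hsub := prefixSet_mono (π := π) hq
    have hnot : gap k' ∉ prefixSet π (nextDivider n R k) := fun hm => (hgap k').1 (hsub hm)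
    refine hgap_le k _ hnot ?_
    -- Otherwise some `b` below `gap k'` is new in the later prefix, and some `a` above it is in the
    -- earlier one. Since `gap k'` is missing from the later prefix, this is a 312 pattern.
    by_contra hle
    rcases hq.eq_or_lt with heq | hlt
    · have h1 := (hgap k').2
      rw [← heq] at h1
      have : (k : ℕ) ≤ k' := hkk
      omega
    have h1 := (hgap k').2
    have hqR : nextDivider n R k ∈ R := by
      rcases nextDivider_mem_or (n := n) (R := R) k with h2 | h2
      · exact h2
      · have := nextDivider_le_top hR k'
        omega
    have hqk : nextDivider n R k ≤ k' := by
      by_contra hlt'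
      have := nextDivider_le (n := n) hqR (not_le.1 hlt')
      omega
    have hcq := card_prefixSet (π := π) (hR _ hqR)
    have hkq := lt_nextDivider (R := R) k.2
    obtain ⟨b, hb, hbn⟩ : ∃ b, b ∈ (prefixSet π (nextDivider n R k')).filter (fun x => x < gap k') ∧
        b ∉ (prefixSet π (nextDivider n R k)).filter (fun x => x < gap k') := by
      by_contra! hall
      have : countBelow (prefixSet π (nextDivider n R k')) (gap k') ≤
          countBelow (prefixSet π (nextDivider n R k)) (gap k') := Finset.card_le_card hall
      omega
    obtain ⟨a, ha, han⟩ : ∃ a, a ∈ prefixSet π (nextDivider n R k) ∧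
        a ∉ (prefixSet π (nextDivider n R k)).filter (fun x => x < gap k') := by
      by_contra! hall
      have : (prefixSet π (nextDivider n R k)).card ≤
          countBelow (prefixSet π (nextDivider n R k)) (gap k') := Finset.card_le_card hall
      omega
    rw [Finset.mem_filter] at hb hbn han
    have ha_le : gap k' ≤ a := by
      by_contra hlt'
      exact han ⟨ha, not_le.1 hlt'⟩
    have ha_ne : a ≠ gap k' := fun heq => hnot (heq ▸ ha)
    have hq'R : nextDivider n R k' ∈ R := by
      rcases nextDivider_mem_or (n := n) (R := R) k' with h2 | h2
      · exact h2
      · refine absurd (mem_prefixSet_of_lt ?_) (h2 ▸ (hgap k').1)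
        exact ha_le.trans_lt (lt_of_mem_prefixSet ha)
    exact not_lt_of_avoiding h hqR hq'R ha hb.1 (fun hb' => hbn ⟨hb', hb.2⟩) (hgap k').1 hb.2
      (lt_of_le_of_ne ha_le ha_ne.symm)
  let φ : Fin n → Fin n := fun k => ⟨gap k - 1, by have := hgap_n k; have := hgap_lt k; omega⟩
  have hφ : IsUpperFlag φ := by
    refine ⟨fun a b hab => ?_, fun k => ?_⟩
    · have := hgap_mono a b hab
      simp only [φ, Fin.mk_le_mk]
      omega
    · have := hgap_lt k
      simp only [φ, Fin.le_def]
      omega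
  have hext : ∀ k : Fin n, extendFlag φ k + 1 = gap k := fun k => by
    have := hgap_lt k
    rw [extendFlag_fin]
    simp only [φ]
    omega
  refine ⟨φ, hφ, fun q hq => Finset.eq_of_subset_of_card_le (fun x hx => ?_) ?_⟩
  swap
  · rw [card_colSet hφ.le_extendFlag, card_prefixSet (hR q hq)]
  have hqn := hR q hq
  have hcq := card_prefixSet (π := π) hqn
  -- `w` is the first missing value after `x`. If `x` has rank `i`, the last element `w - 1` of its
  -- run has rank `i + (w - x) - 1`; the bound in that row forces the entry down to `x`.
  obtain ⟨w, ⟨hxw, hw⟩, hwmin⟩ : ∃ w, (x < w ∧ w ∉ prefixSet π q) ∧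
      ∀ y, x < y → y < w → y ∈ prefixSet π q := by
    have hex : ∃ w, x < w ∧ w ∉ prefixSet π q :=
      ⟨n, lt_of_mem_prefixSet hx, fun h => (lt_of_mem_prefixSet h).false⟩
    refine ⟨Nat.find hex, Nat.find_spec hex, fun y hy hyw => ?_⟩
    by_contra hyn
    exact Nat.find_min hex hyw ⟨hy, hyn⟩
  have hcw : countBelow (prefixSet π q) w = countBelow (prefixSet π q) x + (w - x) := by
    refine countBelow_eq_add hxw.le fun y hy hyw => ?_
    rcases hy.eq_or_lt with rfl | hy
    · exact hx
    · exact hwmin y hy hyw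
  have hwq := countBelow_le_card (prefixSet π q) w
  set i := countBelow (prefixSet π q) x with hi
  refine mem_colSet.2 ⟨i, by omega, le_antisymm ?_ ?_⟩
  · have hk0 : i + (w - x) - 1 < n := by omega
    have h1 := flagCol_add_le hφ.le_extendFlag (l := q) (i := i) (k := i + (w - x) - 1) (by omega)
      (by omega)
    have h2 := hext ⟨i + (w - x) - 1, hk0⟩
    have hnext := nextDivider_le (n := n) hq (show i + (w - x) - 1 < q by omega)
    have hlt := lt_nextDivider (R := R) hk0
    have hsub := prefixSet_mono (π := π) hnext
    have hqR : nextDivider n R (i + (w - x) - 1) ∈ R := by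
      rcases nextDivider_mem_or (n := n) (R := R) (i + (w - x) - 1) with h3 | h3
      · exact h3
      · have : q = n := by omega
        rw [h3, ← this]
        exact hq
    have hgw : gap ⟨i + (w - x) - 1, hk0⟩ ≤ w := by
      refine hgap_le _ _ (fun hm => hw (hsub hm)) ?_
      -- If such a `b` came only after the next divider, avoidance would put that divider's whole
      -- prefix below `w`. Together with `b` it would exceed the number of elements below `w`.
      have heq : (prefixSet π q).filter (fun y => y < w) ⊆
          (prefixSet π (nextDivider n R (i + (w - x) - 1))).filter (fun y => y < w) := by
        intro b hb
        rw [Finset.mem_filter] at hb ⊢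
        refine ⟨?_, hb.2⟩
        by_contra hbn
        have hall : ∀ a ∈ prefixSet π (nextDivider n R (i + (w - x) - 1)), a < w := fun a ha => by
          by_contra hle
          refine not_lt_of_avoiding h hqR hq ha hb.1 hbn hw hb.2 (lt_of_le_of_ne (not_lt.1 hle) ?_)
          rintro rfl
          exact hw (hsub ha)
        have hss : insert b (prefixSet π (nextDivider n R (i + (w - x) - 1))) ⊆
            (prefixSet π q).filter (fun y => y < w) := by
          intro y hy
          rw [Finset.mem_filter]
          rcases Finset.mem_insert.1 hy with rfl | hy
          · exact hb
          · exact ⟨hsub hy, hall y hy⟩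
        have h3 := Finset.card_le_card hss
        rw [Finset.card_insert_of_notMem hbn, card_prefixSet (hR _ hqR)] at h3
        change _ ≤ countBelow (prefixSet π q) w at h3
        omega
      have h3 : countBelow (prefixSet π q) w ≤
          countBelow (prefixSet π (nextDivider n R (i + (w - x) - 1))) w := Finset.card_le_card heq
      simp only
      omega
    simp only at h2
    omega
  -- More than `k ≥ i` elements of the prefix set lie below `gap k`, while only `i` lie below `x`.
  -- Hence `gap k` exceeds `x` by at least `k + 1 - i`.
  · rw [le_flagCol_iff hφ.le_extendFlag (by omega)]
    intro k hik hkq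
    have h1 := hext ⟨k, hkq.trans_le hqn⟩
    have h2 := (hgap ⟨k, hkq.trans_le hqn⟩).2
    have h3 := countBelow_mono_left (prefixSet_mono (π := π) (nextDivider_le (n := n) hq hkq))
      (gap ⟨k, hkq.trans_le hqn⟩)
    simp only at h1 h2
    rcases le_total x (gap ⟨k, hkq.trans_le hqn⟩) with h4 | h4
    · have h5 := countBelow_le_add (prefixSet π q) x (gap ⟨k, hkq.trans_le hqn⟩)
      omega
    · have h5 := countBelow_mono_right (prefixSet π q) h4
      omega

end Permutations

/-! ### Shapes with constant column multiplicity -/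

section Shapes

variable {n m : ℕ} {R S : Finset ℕ} {μ : YoungDiagram}

/-- The shape with exactly `m` columns of each length in `R`. -/
def shape (m : ℕ) (R : Finset ℕ) : YoungDiagram where
  -- The product is only a finite bounding box; the filter alone decides membership.
  cells := (Finset.range (R.sup id) ×ˢ Finset.range (m * R.card)).filter fun c =>
    c.2 < m * (R.filter fun q => c.1 < q).card
  isLowerSet := by
    rintro ⟨i, j⟩ ⟨i', j'⟩ ⟨hi, hj⟩ h
    simp only [Finset.coe_filter, Finset.mem_product, Finset.mem_range, Set.mem_ofPred_eq]
      at h hi hj ⊢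
    refine ⟨⟨by omega, by omega⟩, (hj.trans_lt h.2).trans_le (Nat.mul_le_mul_left m ?_)⟩
    refine Finset.card_le_card fun q hq => ?_
    rw [Finset.mem_filter] at hq ⊢
    exact ⟨hq.1, by omega⟩

theorem mem_shape {i j : ℕ} : (i, j) ∈ shape m R ↔ j < m * (R.filter fun q => i < q).card := by
  rw [← YoungDiagram.mem_cells]
  simp only [shape, Finset.mem_filter, Finset.mem_product, Finset.mem_range, and_iff_right_iff_imp]
  intro h
  have hpos : 0 < (R.filter fun q => i < q).card := by
    by_contra h0
    rw [Nat.eq_zero_of_not_pos h0] at h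
    omega
  obtain ⟨q, hq⟩ := Finset.card_pos.1 hpos
  rw [Finset.mem_filter] at hq
  exact ⟨hq.2.trans_le (Finset.le_sup (f := id) hq.1),
    h.trans_le (Nat.mul_le_mul_left m (Finset.card_filter_le _ _))⟩

theorem rowLen_shape (i : ℕ) : (shape m R).rowLen i = m * (R.filter fun q => i < q).card :=
  eq_of_forall_lt_iff fun j => by rw [← YoungDiagram.mem_iff_lt_rowLen, mem_shape]

theorem card_filter_le_eq (R : Finset ℕ) (q : ℕ) :
    (R.filter fun s => q ≤ s).card = (R.filter fun s => q < s).card + if q ∈ R then 1 else 0 := by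
  split_ifs with hq
  · rw [← Finset.card_insert_of_notMem (a := q) (by simp)]
    congr 1
    ext s
    simp only [Finset.mem_filter, Finset.mem_insert]
    constructor
    · rintro ⟨h1, h2⟩
      rcases h2.eq_or_lt with h3 | h3
      · exact Or.inl h3.symm
      · exact Or.inr ⟨h1, h3⟩
    · rintro (rfl | h)
      · exact ⟨hq, le_rfl⟩
      · exact ⟨h.1, h.2.le⟩
  · rw [add_zero]
    congr 1
    refine Finset.filter_congr fun s hs => ?_
    have : s ≠ q := fun h => hq (h ▸ hs)
    omega

/-- Columns of a given length form an interval, so multiplicities become differences of consecutive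
row lengths. -/
theorem colLen_eq_iff {q j : ℕ} (hq : 0 < q) :
    μ.colLen j = q ↔ μ.rowLen q ≤ j ∧ j < μ.rowLen (q - 1) := by
  rw [← YoungDiagram.mem_iff_lt_rowLen, ← not_lt, ← YoungDiagram.mem_iff_lt_rowLen,
    YoungDiagram.mem_iff_lt_colLen, YoungDiagram.mem_iff_lt_colLen]
  omega

theorem colLen_pos {j : ℕ} (hj : j < μ.rowLen 0) : 0 < μ.colLen j :=
  YoungDiagram.mem_iff_lt_colLen.1 (YoungDiagram.mem_iff_lt_rowLen.2 hj)

theorem rowLen_pred_shape {q : ℕ} (hq : 0 < q) :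
    (shape m R).rowLen (q - 1) = (shape m R).rowLen q + m * if q ∈ R then 1 else 0 := by
  rw [rowLen_shape, rowLen_shape, ← mul_add, ← card_filter_le_eq]
  congr 2
  refine Finset.filter_congr fun s _ => ?_
  omega

theorem colLen_shape_mem {j : ℕ} (hj : j < (shape m R).rowLen 0) : (shape m R).colLen j ∈ R := by
  have h1 := (colLen_eq_iff (colLen_pos hj)).1 rfl
  rw [rowLen_pred_shape (colLen_pos hj)] at h1
  by_contra h
  rw [if_neg h] at h1
  omega

theorem exists_colLen_shape_eq (hm : 1 ≤ m) {q : ℕ} (hq : q ∈ R) (hq0 : 0 < q) :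
    ∃ j < (shape m R).rowLen 0, (shape m R).colLen j = q := by
  have h1 := rowLen_pred_shape (m := m) (R := R) hq0
  rw [if_pos hq] at h1
  have h2 := (shape m R).rowLen_anti 0 (q - 1) (Nat.zero_le _)
  exact ⟨(shape m R).rowLen q, by omega, (colLen_eq_iff hq0).2 ⟨le_rfl, by omega⟩⟩

theorem filter_colLen_eq {q : ℕ} (hq : 0 < q) :
    ((Finset.range (μ.rowLen 0)).filter fun k => μ.colLen k = q) =
      Finset.Ico (μ.rowLen q) (μ.rowLen (q - 1)) := by
  ext k
  rw [Finset.mem_filter, Finset.mem_range, Finset.mem_Ico, colLen_eq_iff hq, and_iff_right_iff_imp]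
  exact fun h => h.2.trans_le (μ.rowLen_anti 0 (q - 1) (Nat.zero_le _))

theorem hasColumnMultiplicity_shape : HasColumnMultiplicity m (shape m R) := by
  intro j hj
  rw [filter_colLen_eq (colLen_pos hj), rowLen_pred_shape (colLen_pos hj),
    if_pos (colLen_shape_mem hj), Nat.card_Ico]
  omega

theorem colLen_shape_le (hR : ∀ q ∈ R, q ≤ n) : (shape m R).colLen 0 ≤ n := by
  by_contra h
  have h0 : 0 < (shape m R).rowLen 0 :=
    YoungDiagram.mem_iff_lt_rowLen.1 (YoungDiagram.mem_iff_lt_colLen.2 (by omega))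
  exact h (hR _ (colLen_shape_mem h0))

theorem exists_eq_shape (h : HasColumnMultiplicity m μ) (hμ : μ.colLen 0 ≤ n) :
    ∃ R ⊆ Finset.Icc 1 n, μ = shape m R := by
  -- `R` is the set of column lengths. Row `i` meets the columns longer than `i`, and there are `m`
  -- of each such length.
  refine ⟨(Finset.range (μ.rowLen 0)).image μ.colLen, fun q hq => ?_, eq_of_rowLen_eq fun i => ?_⟩
  · obtain ⟨j, hj, rfl⟩ := Finset.mem_image.1 hq
    have := μ.colLen_anti 0 j j.zero_le
    have := colLen_pos (Finset.mem_range.1 hj)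
    rw [Finset.mem_Icc]
    omega
  · rw [rowLen_shape, ← Finset.card_range (μ.rowLen i), mul_comm]
    rw [Finset.card_eq_sum_card_fiberwise (f := μ.colLen)
      (t := ((Finset.range (μ.rowLen 0)).image μ.colLen).filter fun q => i < q)]
    · refine Finset.sum_const_nat fun q hq => ?_
      obtain ⟨hq, hiq⟩ := Finset.mem_filter.1 hq
      obtain ⟨j, hj, rfl⟩ := Finset.mem_image.1 hq
      rw [← h j (Finset.mem_range.1 hj)]
      congr 1
      ext k
      simp only [Finset.mem_filter, Finset.mem_range, and_congr_left_iff]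
      intro hk
      rw [← YoungDiagram.mem_iff_lt_rowLen, ← YoungDiagram.mem_iff_lt_rowLen,
        YoungDiagram.mem_iff_lt_colLen, YoungDiagram.mem_iff_lt_colLen]
      omega
    · intro k hk
      have hk := Finset.mem_range.1 (Finset.mem_coe.1 hk)
      have h1 := μ.rowLen_anti 0 i i.zero_le
      exact Finset.mem_coe.2 (Finset.mem_filter.2
        ⟨Finset.mem_image_of_mem _ (Finset.mem_range.2 (hk.trans_le h1)),
          YoungDiagram.mem_iff_lt_colLen.1 (YoungDiagram.mem_iff_lt_rowLen.2 hk)⟩)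

theorem shape_inj (hm : 1 ≤ m) (hR : ∀ q ∈ R, 0 < q) (hS : ∀ q ∈ S, 0 < q)
    (h : shape m R = shape m S) : R = S := by
  have key : ∀ {R S : Finset ℕ}, (∀ q ∈ R, 0 < q) → shape m R = shape m S → R ⊆ S := by
    intro R S hR h q hq
    obtain ⟨j, hj, rfl⟩ := exists_colLen_shape_eq hm hq (hR q hq)
    rw [h] at hj ⊢
    exact colLen_shape_mem hj
  exact (key hR h).antisymm (key hS h.symm)

end Shapes

/-! ### The bijection -/

/-- The pairs of a set of dividers `R` and an `R`-312-avoiding `R`-permutation. -/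
abbrev AvoidingPairs (n : ℕ) : Type :=
  Σ R : {R // R ∈ (Finset.Icc 1 (n - 1)).powerset},
    {π : Equiv.Perm (Fin n) // IsRPermutation R.1 π ∧ ¬ IsR312Containing R.1 π}

theorem card_avoidingPairs (n : ℕ) : Nat.card (AvoidingPairs n) = totalParabolicCatalan n := by
  rw [Nat.card_sigma, totalParabolicCatalan]
  exact Finset.sum_coe_sort _ (parabolicCatalan n)

/-- The flag attached to a pair is chosen arbitrarily: by `rowBoundSum_eq_iff` the polynomial
depends only on `R` and the prefix sets at its dividers. -/
theorem exists_bijective_flagSchurPolynomials (n m : ℕ) (hm : 1 ≤ m) :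
    ∃ F : AvoidingPairs n → MvPolynomial (Fin n) ℤ,
      Function.Injective F ∧ Set.range F = flagSchurPolynomials n m := by
  have hR : ∀ R ∈ (Finset.Icc 1 (n - 1)).powerset, ∀ q ∈ R, 0 < q ∧ q ≤ n - 1 := by
    intro R hR q hq
    have := Finset.mem_Icc.1 (Finset.mem_powerset.1 hR hq)
    omega
  have hcol : ∀ R : {R // R ∈ (Finset.Icc 1 (n - 1)).powerset},
      (shape m R.1).colLen 0 ≤ n - 1 := fun R => colLen_shape_le fun q hq => (hR R.1 R.2 q hq).2
  have hex : ∀ x : AvoidingPairs n, ∃ φ : Fin n → Fin n, IsUpperFlag φ ∧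
      ∀ q ∈ x.1.1, prefixSet x.2.1 q = colSet (extendFlag φ) q := fun x =>
    exists_flag_of_avoiding (fun q hq => by have := hR x.1.1 x.1.2 q hq; omega) x.2.2.2
  choose φ hφ hφπ using hex
  refine ⟨fun x => rowBoundSum (shape m x.1.1) (φ x), ?_, ?_⟩
  · rintro ⟨R, π⟩ ⟨S, ρ⟩ h
    obtain rfl : R = S := Subtype.ext <| shape_inj hm (fun q hq => (hR R.1 R.2 q hq).1)
      (fun q hq => (hR S.1 S.2 q hq).1)
      (eq_of_rowLen_eq (rowLen_eq_of_rowBoundSum_eq (hcol R) (hcol S) (hφ _) (hφ _) h))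
    have h1 := (rowBoundSum_eq_iff (hcol R) (hφ _) (hφ _)).1 h
    obtain rfl : π = ρ := Subtype.ext <| eq_of_prefixSet_eq π.2.1 ρ.2.1 fun q hq => by
      obtain ⟨j, hj, hjq⟩ := exists_colLen_shape_eq hm hq (hR R.1 R.2 q hq).1
      have h2 := h1 j hj
      rw [hjq] at h2
      exact (hφπ ⟨R, π⟩ q hq).trans (h2.trans (hφπ ⟨R, ρ⟩ q hq).symm)
    rfl
  · ext f
    constructor
    · rintro ⟨x, rfl⟩
      exact ⟨shape m x.1.1, φ x, hcol x.1, hasColumnMultiplicity_shape, hφ x, rfl⟩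
    · rintro ⟨μ, ψ, hμ, hmult, hψ, rfl⟩
      obtain ⟨R, hRs, rfl⟩ := exists_eq_shape hmult hμ
      have hRp := Finset.mem_powerset.2 hRs
      obtain ⟨π, hπ, h⟩ := exists_avoiding_of_flag (R := R)
        (fun q hq => by have := hR R hRp q hq; omega) hψ
      refine ⟨⟨⟨R, hRp⟩, ⟨π, hπ⟩⟩, (rowBoundSum_eq_iff hμ (hφ _) hψ).2 fun j hj => ?_⟩
      have hq := colLen_shape_mem hj
      exact (hφπ ⟨⟨R, hRp⟩, ⟨π, hπ⟩⟩ _ hq).symm.trans (h _ hq)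

end ParabolicCatalan

theorem corollary13p2 (n m : ℕ) (hn : 1 ≤ n) (hm : 1 ≤ m) :
    (ParabolicCatalan.flagSchurPolynomials n m).Finite ∧
      (ParabolicCatalan.flagSchurPolynomials n m).ncard =
        ParabolicCatalan.totalParabolicCatalan n := by
  obtain ⟨F, hF, hrange⟩ := ParabolicCatalan.exists_bijective_flagSchurPolynomials n m hm
  rw [← hrange, ← ParabolicCatalan.card_avoidingPairs]
  refine ⟨Set.finite_range F, ?_⟩
  rw [← Set.image_univ, Set.ncard_image_of_injective _ hF, Set.ncard_univ]
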